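/- All manifolds are smooth ($C^\infty$), connected, Hausdorff, paracompact and without boundary. A geometric structure on a manifold $M$ is a smooth, pointwise non-degenerate $(0,2)$-tensor field $b$ on $M$ (not necessarily symmetric or skew-symmetric). For $F\in C^\infty(M,\mathbb R)$, the left-gradient $\nabla^L_bF$ and the right-gradient $\nabla^R_bF$ are the smooth vector fields uniquely determined by $$b(\nabla^L_bF,X)=\mathrm dF\cdot X,\qquad b(X,\nabla^R_bF)=\mathrm dF\cdot X\qquad\text{for all smooth vector fields }X\text{ on }M.$$ If $\mu$ is a volume form on $M$ (a smooth nowhere vanishing form of degree $\dim M$), the divergence $\operatorname{div}_\mu X$ of a smooth vector field $X$ is the smooth function uniquely determined by $\mathcal L_X\mu=(\operatorname{div}_\mu X)\,\mu$, where $\mathcal L_X$ is the Lie derivative, and the left- and right-Laplacian of $F$ are $$\Delta^L_{b,\mu}F=\operatorname{div}_\mu(\nabla^L_bF),\qquad \Delta^R_{b,\mu}F=\operatorname{div}_\mu(\nabla^R_bF).$$ **Theorem 4.9.** Let $M$ and $N$ be manifolds of the same dimension $n$, with volume forms $\mu^M,\mu^N$ and geometric structures $b^M,b^N$. Let $\Phi:M\to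 N$ be a ($C^\infty$) diffeomorphism with $\Phi^*b^N=b^M$ (that is, $\Phi$ is a geometromorphism) and $\Phi^*\mu^N=\mu^M$. Then for every $F\in C^\infty(N,\mathbb R)$, $$\Delta^L_{b^M,\mu^M}(\Phi^*F)=\Phi^*\big(\Delta^L_{b^N,\mu^N}F\big)\qquad\text{and}\qquad \Delta^R_{b^M,\mu^M}(\Phi^*F)=\Phi^*\big(\Delta^R_{b^N,\mu^N}F\big),$$ where $\Phi^*F=F\circ\Phi$. -/

import Mathlib

open scoped Manifold ContDiff Topology
open VectorField Bundle

namespace GeometricLaplacian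

/-- Smooth vector fields on an `n`-dimensional smooth manifold `M` without boundary. -/
abbrev SmoothVectorField (n : ℕ) (M : Type*) [TopologicalSpace M]
    [ChartedSpace (EuclideanSpace ℝ (Fin n)) M] [IsManifold (𝓡 n) ∞ M] :=
  ContMDiffSection (𝓡 n) (EuclideanSpace ℝ (Fin n)) ∞ (fun p : M => TangentSpace (𝓡 n) p)

/-- Smooth real-valued functions on `M`. -/
abbrev SmoothFunction (n : ℕ) (M : Type*) [TopologicalSpace M]
    [ChartedSpace (EuclideanSpace ℝ (Fin n)) M] :=
  ContMDiffMap (𝓡 n) 𝓘(ℝ, ℝ) M ℝ ∞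

/-- A geometric structure: a smooth, pointwise non-degenerate `(0,2)`-tensor field; no symmetry is
assumed. (As the tangent spaces are finite-dimensional, non-degeneracy in one of the two arguments
is the same as non-degeneracy in the other.) -/
structure GeometricStructure (n : ℕ) (M : Type*) [TopologicalSpace M]
    [ChartedSpace (EuclideanSpace ℝ (Fin n)) M] [IsManifold (𝓡 n) ∞ M] where
  form : ∀ p : M, TangentSpace (𝓡 n) p →ₗ[ℝ] TangentSpace (𝓡 n) p →ₗ[ℝ] ℝ
  smooth : ∀ X Y : SmoothVectorField n M,
    ContMDiff (𝓡 n) 𝓘(ℝ, ℝ) ∞ (fun p => form p (X p) (Y p))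
  nondegenerate : ∀ (p : M) (v : TangentSpace (𝓡 n) p), (∀ w, form p v w = 0) → v = 0

/-- A volume form: a smooth nowhere vanishing differential form of degree `n = dim M`. -/
structure VolumeForm (n : ℕ) (M : Type*) [TopologicalSpace M]
    [ChartedSpace (EuclideanSpace ℝ (Fin n)) M] [IsManifold (𝓡 n) ∞ M] where
  form : ∀ p : M, TangentSpace (𝓡 n) p [⋀^Fin n]→ₗ[ℝ] ℝ
  smooth : ∀ Y : Fin n → SmoothVectorField n M,
    ContMDiff (𝓡 n) 𝓘(ℝ, ℝ) ∞ (fun p => form p (fun i => Y i p))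
  ne_zero : ∀ p : M, form p ≠ 0

section
variable {n : ℕ} {M : Type*} [TopologicalSpace M]
    [ChartedSpace (EuclideanSpace ℝ (Fin n)) M] [IsManifold (𝓡 n) ∞ M]

/-- `G` is the left-gradient of `F`: `b(G, X) = dF(X)` for every smooth vector field `X`. -/
def IsLeftGradient (b : GeometricStructure n M) (F : SmoothFunction n M)
    (G : SmoothVectorField n M) : Prop :=
  ∀ (X : SmoothVectorField n M) (p : M),
    b.form p (G p) (X p) = mvfderiv (𝓡 n) F p (X p)

/-- `G` is the right-gradient of `F`: `b(X, G) = dF(X)` for every smooth vector field `X`. -/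
def IsRightGradient (b : GeometricStructure n M) (F : SmoothFunction n M)
    (G : SmoothVectorField n M) : Prop :=
  ∀ (X : SmoothVectorField n M) (p : M),
    b.form p (X p) (G p) = mvfderiv (𝓡 n) F p (X p)

/-- The Lie derivative of `μ` along `X`, evaluated on vector fields `Y₁, …, Yₙ`:
`(𝓛_X μ)(Y₁, …, Yₙ) = X(μ(Y₁, …, Yₙ)) - ∑ᵢ μ(Y₁, …, [X, Yᵢ], …, Yₙ)`. -/
noncomputable def lieDerivative (X : SmoothVectorField n M) (μ : VolumeForm n M)
    (Y : Fin n → SmoothVectorField n M) (p : M) : ℝ :=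
  mvfderiv (𝓡 n) (fun q => μ.form q (fun i => Y i q)) p (X p)
    - ∑ i, μ.form p
        (Function.update (fun j => Y j p) i (mlieBracket (𝓡 n) X (Y i) p))

/-- `δ` is the divergence of `X` with respect to `μ`: `𝓛_X μ = δ μ`. -/
def IsDivergence (μ : VolumeForm n M) (X : SmoothVectorField n M) (δ : SmoothFunction n M) : Prop :=
  ∀ (Y : Fin n → SmoothVectorField n M) (p : M),
    lieDerivative X μ Y p = δ p * μ.form p (fun i => Y i p)

/-! ### Existence and uniqueness of gradients and of the divergence -/

theorem contMDiff_mvfderiv_apply (F : SmoothFunction n M) (X : SmoothVectorField n M) :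
    ContMDiff (𝓡 n) 𝓘(ℝ, ℝ) ∞ (fun p => mvfderiv (𝓡 n) F p (X p)) := by
  have h1 : ContMDiff (𝓡 n).tangent 𝓘(ℝ, ℝ).tangent ∞ (tangentMap (𝓡 n) 𝓘(ℝ, ℝ) F) :=
    F.contMDiff.contMDiff_tangentMap le_rfl
  have h2 := (contMDiff_snd_tangentBundle_modelSpace ℝ 𝓘(ℝ, ℝ) (n := ∞)).comp (h1.comp X.contMDiff)
  exact h2

theorem contMDiff_mlieBracket (X Y : SmoothVectorField n M) :
    ContMDiff (𝓡 n) ((𝓡 n).prod 𝓘(ℝ, EuclideanSpace ℝ (Fin n))) ∞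
      (fun p => TotalSpace.mk' (EuclideanSpace ℝ (Fin n)) p (mlieBracket (𝓡 n) X Y p)) := by
  intro p
  have h1 : IsManifold (𝓡 n) (((⊤ : ℕ∞) : WithTop ℕ∞) + 1) M := by
    have : (((⊤ : ℕ∞) : WithTop ℕ∞) + 1) = ∞ := rfl
    rw [this]; infer_instance
  have h2 : IsManifold (𝓡 n) (minSmoothness ℝ 2) M := by
    rw [minSmoothness_of_isRCLikeNormedField]; infer_instance
  have h3 : IsManifold (𝓡 n) (minSmoothness ℝ 3) M := by
    rw [minSmoothness_of_isRCLikeNormedField]; infer_instance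
  exact ContMDiffAt.mlieBracket_vectorField (m := ⊤) (n := ⊤) (X.contMDiff p) (Y.contMDiff p)
    (by simp)

/-- Multiplication of a smooth vector field by a smooth function. -/
noncomputable def mulField (f : SmoothFunction n M) (Y : SmoothVectorField n M) : SmoothVectorField n M :=
  ⟨fun q => f q • Y q, f.contMDiff.smul_section Y.contMDiff⟩

theorem mulField_apply (f : SmoothFunction n M) (Y : SmoothVectorField n M) (q : M) :
    mulField f Y q = f q • Y q := rfl

theorem sum_field_apply {ι : Type*} (s : Finset ι) (Y : ι → SmoothVectorField n M) (q : M) :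
    (∑ i ∈ s, Y i) q = ∑ i ∈ s, Y i q := by
  have h := map_sum (ContMDiffSection.coeAddHom (𝓡 n) (EuclideanSpace ℝ (Fin n)) ∞
    (fun p : M => TangentSpace (𝓡 n) p)) Y s
  have h' := congrFun h q
  rw [Finset.sum_apply] at h'
  exact h'

theorem exists_frame [T2Space M] (p : M) :
    ∃ (χ : SmoothFunction n M) (s : Fin n → SmoothVectorField n M),
    χ p = 1 ∧ (∀ᶠ q in 𝓝 p, LinearIndependent ℝ (fun j => s j q)) ∧
    ∀ Y : SmoothVectorField n M, ∃ c : Fin n → SmoothFunction n M,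
      mulField (χ * χ) Y = ∑ j, mulField (c j) (s j) := by
  classical
  obtain ⟨χ⟩ := (inferInstance : Nonempty (SmoothBumpFunction (𝓡 n) p))
  let e := trivializationAt (EuclideanSpace ℝ (Fin n)) (fun p : M => TangentSpace (𝓡 n) p) p
  let b := (EuclideanSpace.basisFun (Fin n) ℝ).toBasis
  have hbase : e.baseSet = (chartAt (EuclideanSpace ℝ (Fin n)) p).source := rfl
  let s : Fin n → SmoothVectorField n M := fun j =>
    ⟨(fun q => χ q) • e.localFrame b j, by
      refine ContMDiffOn.smul_section_of_tsupport (u := e.baseSet) χ.contMDiff.contMDiffOn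
        e.open_baseSet ?_ (e.contMDiffOn_localFrame_baseSet ∞ b j)
      rw [hbase]; exact χ.tsupport_subset_chartAt_source⟩
  have hs : ∀ j q, s j q = χ q • e.localFrame b j q := fun j q => rfl
  refine ⟨⟨χ, χ.contMDiff⟩, s, χ.eq_one, ?_, ?_⟩
  · have h1 : ∀ᶠ q in 𝓝 p, q ∈ e.baseSet :=
      e.open_baseSet.mem_nhds (FiberBundle.mem_baseSet_trivializationAt' p)
    filter_upwards [h1, χ.eventuallyEq_one] with q hq hχ
    have h2 : (fun j => s j q) = e.basisAt b hq := by
      funext j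
      rw [hs, hχ, e.localFrame_apply_of_mem_baseSet b hq]
      simp
    rw [h2]
    exact (e.basisAt b hq).linearIndependent
  · intro Y
    refine ⟨fun j => ⟨fun q => χ q • LinearMap.piApply (e.localFrameCoeff (𝓡 n) b j) Y q,
      χ.contMDiff_smul (contMDiffOn_baseSet_localFrameCoeff (e := e) b
        Y.contMDiff.contMDiffOn j)⟩, ?_⟩
    ext1 q
    rw [sum_field_apply]
    change (χ q * χ q) • Y q =
      ∑ j, (χ q • e.localFrameCoeff (𝓡 n) b j q (Y q)) • χ q • e.localFrame b j q
    by_cases hq : q ∈ e.baseSet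
    · have h3 := e.eq_sum_localFrameCoeff_smul (I := 𝓡 n) (b := b) (s := Y) hq
      conv_lhs => rw [h3]
      rw [Finset.smul_sum]
      refine Finset.sum_congr rfl fun j _ => ?_
      simp only [smul_smul, smul_eq_mul]
      congr 1; ring
    · have h0 : χ q = 0 := by
        by_contra h
        exact hq (hbase ▸ χ.support_subset_source h)
      simp [h0]

instance finiteDimensional_tangentSpace (p : M) :
    FiniteDimensional ℝ (TangentSpace (𝓡 n) p) :=
  inferInstanceAs (FiniteDimensional ℝ (EuclideanSpace ℝ (Fin n)))

theorem exists_basis_of_linearIndependent {p : M} {v : Fin n → TangentSpace (𝓡 n) p}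
    (hv : LinearIndependent ℝ v) :
    ∃ e : Module.Basis (Fin n) ℝ (TangentSpace (𝓡 n) p), ⇑e = v := by
  rcases n with _ | m
  · exact ⟨(Module.Basis.mk hv (by
      have : Subsingleton (TangentSpace (𝓡 0) p) :=
        inferInstanceAs (Subsingleton (EuclideanSpace ℝ (Fin 0)))
      exact (Subsingleton.elim _ _).le)), by simp⟩
  · exact ⟨basisOfLinearIndependentOfCardEqFinrank hv ((Fintype.card_fin _).trans (finrank_euclideanSpace_fin (𝕜 := ℝ)).symm), by simp⟩

theorem exists_field_eq [T2Space M] (p : M) (v : TangentSpace (𝓡 n) p) :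
    ∃ Y : SmoothVectorField n M, Y p = v := by
  obtain ⟨χ, s, -, hs, -⟩ := exists_frame (n := n) p
  obtain ⟨e, he⟩ := exists_basis_of_linearIndependent hs.self_of_nhds
  refine ⟨∑ j, (e.repr v j) • s j, ?_⟩
  rw [sum_field_apply]
  conv_rhs => rw [← e.sum_repr v]
  simp [he]

/-! #### Gradients -/

theorem existsUnique_leftGradient [T2Space M] (b : GeometricStructure n M)
    (F : SmoothFunction n M) : ∃! G : SmoothVectorField n M, IsLeftGradient b F G := by
  classical
  have hsurj : ∀ p : M, ∃ v : TangentSpace (𝓡 n) p, ∀ w, b.form p v w = mvfderiv (𝓡 n) F p w := by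
    intro p
    have hinj : Function.Injective (b.form p) := by
      rw [injective_iff_map_eq_zero]
      intro v hv
      exact b.nondegenerate p v (fun w => by rw [hv]; rfl)
    have hs := (LinearMap.injective_iff_surjective_of_finrank_eq_finrank
      (f := (b.form p : TangentSpace (𝓡 n) p →ₗ[ℝ] Module.Dual ℝ (TangentSpace (𝓡 n) p)))
      (Subspace.dual_finrank_eq).symm).1 hinj
    obtain ⟨v, hv⟩ := hs (mvfderiv (𝓡 n) F p).toLinearMap
    exact ⟨v, fun w => by rw [hv]; rfl⟩
  choose G hG using hsurj
  have hsmooth : ContMDiff (𝓡 n) ((𝓡 n).prod 𝓘(ℝ, EuclideanSpace ℝ (Fin n))) ∞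
      (fun p => TotalSpace.mk' (EuclideanSpace ℝ (Fin n)) p (G p)) := by
    intro p
    obtain ⟨χ, s, -, hs, -⟩ := exists_frame (n := n) p
    let A : M → Matrix (Fin n) (Fin n) ℝ := fun q => Matrix.of fun j i => b.form q (s i q) (s j q)
    let d : M → Fin n → ℝ := fun q j => mvfderiv (𝓡 n) F q (s j q)
    have hdet : ∀ B : M → Matrix (Fin n) (Fin n) ℝ,
        (∀ i j, ContMDiff (𝓡 n) 𝓘(ℝ, ℝ) ∞ (fun q => B q i j)) →
        ContMDiff (𝓡 n) 𝓘(ℝ, ℝ) ∞ (fun q => (B q).det) := by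
      intro B hB
      simp only [Matrix.det_apply']
      exact ContMDiff.sum fun σ _ => contMDiff_const.mul (ContMDiff.prod fun i _ => hB _ _)
    have hA : ∀ i j, ContMDiff (𝓡 n) 𝓘(ℝ, ℝ) ∞ (fun q => A q i j) := fun i j =>
      b.smooth (s j) (s i)
    have hcr : ∀ i, ContMDiff (𝓡 n) 𝓘(ℝ, ℝ) ∞ (fun q => (A q).cramer (d q) i) := by
      intro i
      simp only [Matrix.cramer_apply]
      refine hdet _ fun k l => ?_
      by_cases h : l = i
      · subst h
        simpa [Matrix.updateCol_apply] using contMDiff_mvfderiv_apply F (s k)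
      · simpa [Matrix.updateCol_apply, h] using hA k l
    have hdetne : ∀ᶠ q in 𝓝 p, (A q).det ≠ 0 := by
      filter_upwards [hs] with q hq h0
      obtain ⟨e, he⟩ := exists_basis_of_linearIndependent hq
      obtain ⟨v, hv0, hv⟩ := Matrix.exists_mulVec_eq_zero_iff.2 h0
      apply hv0
      have h1 : ∑ i, v i • s i q = 0 := by
        apply b.nondegenerate q
        intro w
        have h2 : b.form q (∑ i, v i • s i q) = 0 := by
          refine e.ext fun j => ?_
          have h3 := congrFun hv j
          simp only [Matrix.mulVec, dotProduct, A, Matrix.of_apply, Pi.zero_apply] at h3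
          rw [he]
          simp only [map_sum, map_smul, LinearMap.sum_apply, LinearMap.smul_apply, smul_eq_mul,
            LinearMap.zero_apply]
          rw [← h3]
          exact Finset.sum_congr rfl fun i _ => mul_comm _ _
        rw [h2]; rfl
      funext i
      exact Fintype.linearIndependent_iff.1 hq v h1 i
    have hloc : ∀ᶠ q in 𝓝 p,
        G q = ∑ i, (((A q).det)⁻¹ * (A q).cramer (d q) i) • s i q := by
      filter_upwards [hs, hdetne] with q hq hne
      obtain ⟨e, he⟩ := exists_basis_of_linearIndependent hq
      rw [← sub_eq_zero]
      apply b.nondegenerate q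
      intro w
      have h2 : b.form q (G q - ∑ i, (((A q).det)⁻¹ * (A q).cramer (d q) i) • s i q) = 0 := by
        refine e.ext fun j => ?_
        have h3 := congrFun (Matrix.mulVec_cramer (A q) (d q)) j
        simp only [Matrix.mulVec, dotProduct, Pi.smul_apply, smul_eq_mul] at h3
        rw [he]
        simp only [map_sub, map_sum, map_smul, LinearMap.sub_apply, LinearMap.sum_apply,
          LinearMap.smul_apply, smul_eq_mul, LinearMap.zero_apply, hG]
        have h4 : ∑ i, (A q).det⁻¹ * (A q).cramer (d q) i * b.form q (s i q) (s j q)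
            = (A q).det⁻¹ * ∑ i, A q j i * (A q).cramer (d q) i := by
          rw [Finset.mul_sum]
          refine Finset.sum_congr rfl fun i _ => ?_
          simp only [A, Matrix.of_apply]; ring
        rw [h4, h3]
        simp only [d]
        field_simp
        ring
      rw [h2]; rfl
    have hsm : ContMDiffAt (𝓡 n) ((𝓡 n).prod 𝓘(ℝ, EuclideanSpace ℝ (Fin n))) ∞
        (fun q => TotalSpace.mk' (EuclideanSpace ℝ (Fin n)) q
          (∑ i, (((A q).det)⁻¹ * (A q).cramer (d q) i) • s i q)) p := by
      refine ContMDiffAt.sum_section fun i _ => ?_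
      refine ContMDiffAt.smul_section ?_ ((s i).contMDiff p)
      exact ((hdet A hA p).inv₀ hdetne.self_of_nhds).mul (hcr i p)
    refine hsm.congr_of_eventuallyEq ?_
    filter_upwards [hloc] with q hq
    rw [hq]
  refine ⟨⟨G, hsmooth⟩, fun X p => hG p (X p), fun G' hG' => ?_⟩
  ext1 p
  rw [← sub_eq_zero]
  apply b.nondegenerate p
  intro w
  obtain ⟨W, rfl⟩ := exists_field_eq p w
  rw [map_sub, LinearMap.sub_apply, hG' W p]
  exact sub_eq_zero.2 (hG p (W p)).symm

/-- The geometric structure with the two arguments exchanged. -/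
noncomputable def GeometricStructure.flip (b : GeometricStructure n M) : GeometricStructure n M where
  form p := (b.form p).flip
  smooth X Y := b.smooth Y X
  nondegenerate p v hv := by
    have hinj : Function.Injective (b.form p) := by
      rw [injective_iff_map_eq_zero]
      intro v hv
      exact b.nondegenerate p v (fun w => by rw [hv]; rfl)
    have hs := (LinearMap.injective_iff_surjective_of_finrank_eq_finrank
      (f := (b.form p : TangentSpace (𝓡 n) p →ₗ[ℝ] Module.Dual ℝ (TangentSpace (𝓡 n) p)))
      (Subspace.dual_finrank_eq).symm).1 hinj
    refine (Module.forall_dual_apply_eq_zero_iff ℝ v).1 fun f => ?_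
    obtain ⟨w, rfl⟩ := hs f
    exact hv w

theorem existsUnique_rightGradient [T2Space M] (b : GeometricStructure n M)
    (F : SmoothFunction n M) : ∃! G : SmoothVectorField n M, IsRightGradient b F G :=
  existsUnique_leftGradient b.flip F

/-! #### Divergence -/

theorem update_apply_field {ι : Type*} [DecidableEq ι] (Y : ι → SmoothVectorField n M) (i : ι)
    (Z : SmoothVectorField n M) (q : M) :
    (fun j => (Function.update Y i Z j) q) = Function.update (fun j => Y j q) i (Z q) := by
  funext j
  by_cases h : j = i
  · subst h; simp
  · simp [h]

theorem lieDerivative_update (X : SmoothVectorField n M) (μ : VolumeForm n M)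
    (Y : Fin n → SmoothVectorField n M) (i : Fin n) (Z : SmoothVectorField n M) (p : M) :
    lieDerivative X μ (Function.update Y i Z) p =
      mvfderiv (𝓡 n) (fun q => μ.form q (Function.update (fun j => Y j q) i (Z q))) p (X p)
      - (μ.form p (Function.update (fun j => Y j p) i (mlieBracket (𝓡 n) X Z p))
        + ∑ k ∈ Finset.univ.erase i, μ.form p (Function.update (Function.update (fun j => Y j p) k
            (mlieBracket (𝓡 n) X (Y k) p)) i (Z p))) := by
  rw [lieDerivative, ← Finset.add_sum_erase _ _ (Finset.mem_univ i)]
  simp only [update_apply_field]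
  congr 2
  · simp
  · refine Finset.sum_congr rfl fun k hk => ?_
    have hki : k ≠ i := Finset.ne_of_mem_erase hk
    rw [Function.update_comm hki.symm]
    simp [hki]

theorem mdifferentiableAt_form (μ : VolumeForm n M) (Y : Fin n → SmoothVectorField n M) (p : M) :
    MDifferentiableAt (𝓡 n) 𝓘(ℝ, ℝ) (fun q => μ.form q (fun i => Y i q)) p :=
  (μ.smooth Y p).mdifferentiableAt (by simp)

theorem lieDerivative_update_add (X : SmoothVectorField n M) (μ : VolumeForm n M)
    (Y : Fin n → SmoothVectorField n M) (i : Fin n) (Z W : SmoothVectorField n M) (p : M) :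
    lieDerivative X μ (Function.update Y i (Z + W)) p =
      lieDerivative X μ (Function.update Y i Z) p + lieDerivative X μ (Function.update Y i W) p := by
  have hZ := mdifferentiableAt_form μ (Function.update Y i Z) p
  have hW := mdifferentiableAt_form μ (Function.update Y i W) p
  simp only [update_apply_field] at hZ hW
  have h1 : mlieBracket (𝓡 n) X (⇑(Z + W)) p
      = mlieBracket (𝓡 n) X Z p + mlieBracket (𝓡 n) X W p := by
    exact mlieBracket_add_right Z.mdifferentiableAt W.mdifferentiableAt
  simp only [lieDerivative_update, h1]
  simp only [ContMDiffSection.coe_add, Pi.add_apply,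
    AlternatingMap.map_update_add, Finset.sum_add_distrib]
  have h2 := mvfderiv_add hZ hW
  have h3 : mvfderiv (𝓡 n) (fun q => μ.form q (Function.update (fun j => Y j q) i (Z q))
      + μ.form q (Function.update (fun j => Y j q) i (W q))) p (X p) = _ :=
    congrArg (fun f => f (X p)) h2
  rw [h3]
  simp only [add_apply]
  ring

theorem lieDerivative_update_mulField (X : SmoothVectorField n M) (μ : VolumeForm n M)
    (Y : Fin n → SmoothVectorField n M) (i : Fin n) (f : SmoothFunction n M)
    (Z : SmoothVectorField n M) (p : M) :
    lieDerivative X μ (Function.update Y i (mulField f Z)) p =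
      f p * lieDerivative X μ (Function.update Y i Z) p := by
  have hZ := mdifferentiableAt_form μ (Function.update Y i Z) p
  simp only [update_apply_field] at hZ
  have hf : MDifferentiableAt (𝓡 n) 𝓘(ℝ, ℝ) f p := (f.contMDiff p).mdifferentiableAt (by simp)
  have h1 : mlieBracket (𝓡 n) X (⇑(mulField f Z)) p
      = mvfderiv (𝓡 n) f p (X p) • Z p + f p • mlieBracket (𝓡 n) X Z p :=
    mlieBracket_smul_right hf Z.mdifferentiableAt
  have h2 := mvfderiv_mul hf hZ
  have h3 : mvfderiv (𝓡 n) (fun q => f q * μ.form q (Function.update (fun j => Y j q) i (Z q)))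
      p (X p) = _ := congrArg (fun f => f (X p)) h2
  simp only [lieDerivative_update, h1, mulField_apply, AlternatingMap.map_update_add,
    AlternatingMap.map_update_smul, smul_eq_mul]
  rw [h3, ← Finset.mul_sum]
  simp only [add_apply, smul_apply, smul_eq_mul]
  ring

theorem lieDerivative_eq_zero_of_eq (X : SmoothVectorField n M) (μ : VolumeForm n M)
    (Y : Fin n → SmoothVectorField n M) {i j : Fin n} (hij : i ≠ j) (h : Y i = Y j) (p : M) :
    lieDerivative X μ Y p = 0 := by
  have h0 : (fun q => μ.form q (fun i => Y i q)) = fun _ => (0 : ℝ) := by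
    funext q
    exact (μ.form q).map_eq_zero_of_eq _ (by rw [h]) hij
  rw [lieDerivative, h0, mvfderiv_const]
  have hj : j ∈ Finset.univ.erase i := Finset.mem_erase.2 ⟨hij.symm, Finset.mem_univ _⟩
  rw [← Finset.add_sum_erase _ _ (Finset.mem_univ i), ← Finset.add_sum_erase _ _ hj,
    Finset.sum_eq_zero (s := (Finset.univ.erase i).erase j)]
  · have h5 := (μ.form p).map_swap (Function.update (fun k => Y k p) i
      (mlieBracket (𝓡 n) X (Y i) p)) hij
    have h6 : (Function.update (fun k => Y k p) i (mlieBracket (𝓡 n) X (Y i) p)) ∘ Equiv.swap i j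
        = Function.update (fun k => Y k p) j (mlieBracket (𝓡 n) X (Y j) p) := by
      funext k
      by_cases hki : k = i
      · subst hki
        simp [hij, hij.symm, h]
      · by_cases hkj : k = j
        · subst hkj
          simp [h]
        · simp [Equiv.swap_apply_of_ne_of_ne hki hkj, hki, hkj]
    rw [h6] at h5
    rw [h5]; simp
  · intro k hk
    have hkj : k ≠ j := Finset.ne_of_mem_erase hk
    have hki : k ≠ i := Finset.ne_of_mem_erase (Finset.mem_of_mem_erase hk)
    refine (μ.form p).map_eq_zero_of_eq _ (i := i) (j := j) ?_ hij
    simp [hki.symm, hkj.symm, h]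

/-- At a point, the Lie derivative of `μ` as an alternating map on smooth vector fields. -/
noncomputable def lieDerivativeAlternating (X : SmoothVectorField n M) (μ : VolumeForm n M)
    (p : M) : SmoothVectorField n M [⋀^Fin n]→ₗ[ℝ] ℝ where
  toFun Y := lieDerivative X μ Y p
  map_update_add' {inst} Y i Z W := by
    rw [Subsingleton.elim inst (instDecidableEqFin n)]
    exact lieDerivative_update_add X μ Y i Z W p
  map_update_smul' {inst} Y i c Z := by
    rw [Subsingleton.elim inst (instDecidableEqFin n)]
    exact lieDerivative_update_mulField X μ Y i ⟨fun _ => c, contMDiff_const⟩ Z p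
  map_eq_zero_of_eq' Y i j h hij := lieDerivative_eq_zero_of_eq X μ Y hij h p

theorem lieDerivative_eq_zero_of_apply [T2Space M] (X : SmoothVectorField n M) (μ : VolumeForm n M)
    (Y : Fin n → SmoothVectorField n M) (i : Fin n) (p : M) (h : Y i p = 0) :
    lieDerivative X μ Y p = 0 := by
  obtain ⟨χ, s, hχ, hs, hc⟩ := exists_frame (n := n) p
  obtain ⟨c, hc⟩ := hc (Y i)
  have h1 : lieDerivative X μ Y p
      = lieDerivative X μ (Function.update Y i (mulField (χ * χ) (Y i))) p := by
    rw [lieDerivative_update_mulField, Function.update_eq_self]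
    simp [hχ]
  have h2 : ∑ j, c j p • s j p = 0 := by
    have := congrArg (fun Z : SmoothVectorField n M => Z p) hc
    simp only [sum_field_apply, mulField_apply, h, smul_zero] at this
    exact this.symm
  have h3 := Fintype.linearIndependent_iff.1 hs.self_of_nhds (fun j => c j p) h2
  rw [h1, hc]
  change lieDerivativeAlternating X μ p _ = 0
  rw [AlternatingMap.map_update_sum]
  refine Finset.sum_eq_zero fun j _ => ?_
  change lieDerivative X μ _ p = 0
  rw [lieDerivative_update_mulField, h3 j, zero_mul]

theorem lieDerivative_congr [T2Space M] (X : SmoothVectorField n M) (μ : VolumeForm n M)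
    (Y Y' : Fin n → SmoothVectorField n M) (p : M) (h : ∀ i, Y i p = Y' i p) :
    lieDerivative X μ Y p = lieDerivative X μ Y' p := by
  classical
  suffices H : ∀ s : Finset (Fin n), lieDerivative X μ (s.piecewise Y' Y) p
      = lieDerivative X μ Y p by
    simpa using (H Finset.univ).symm
  intro s
  induction s using Finset.induction_on with
  | empty => simp
  | insert a s ha ih =>
    rw [← ih, Finset.piecewise_insert]
    have h1 : s.piecewise Y' Y = Function.update (s.piecewise Y' Y) a (Y a) := by
      funext k
      by_cases hk : k = a
      · subst hk; simp [ha]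
      · simp [hk]
    conv_rhs => rw [h1]
    rw [← sub_eq_zero]
    change lieDerivativeAlternating X μ p _ - lieDerivativeAlternating X μ p _ = 0
    rw [← AlternatingMap.map_update_sub]
    refine lieDerivative_eq_zero_of_apply X μ _ a p ?_
    simp [h a]

theorem form_frame_ne_zero (μ : VolumeForm n M) {p : M} {v : Fin n → TangentSpace (𝓡 n) p}
    (hv : LinearIndependent ℝ v) : μ.form p v ≠ 0 := by
  obtain ⟨e, he⟩ := exists_basis_of_linearIndependent hv
  intro h
  apply μ.ne_zero p
  rw [(μ.form p).eq_smul_basis_det e, he, h, zero_smul]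

theorem lieDerivative_mul_form [T2Space M] (X : SmoothVectorField n M) (μ : VolumeForm n M)
    (s Y : Fin n → SmoothVectorField n M) (p : M) (hs : LinearIndependent ℝ (fun j => s j p)) :
    lieDerivative X μ Y p * μ.form p (fun j => s j p)
      = lieDerivative X μ s p * μ.form p (fun j => Y j p) := by
  obtain ⟨e, he⟩ := exists_basis_of_linearIndependent hs
  let ev : SmoothVectorField n M →ₗ[ℝ] TangentSpace (𝓡 n) p :=
    { toFun := fun Z => Z p, map_add' := fun _ _ => rfl, map_smul' := fun _ _ => rfl }
  obtain ⟨σ, hσ⟩ := ev.exists_rightInverse_of_surjective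
    (LinearMap.range_eq_top.2 fun v => exists_field_eq p v)
  have hσ' : ∀ v, (σ v) p = v := fun v => LinearMap.congr_fun hσ v
  have key : ∀ Z : Fin n → SmoothVectorField n M, lieDerivative X μ Z p
      = (lieDerivativeAlternating X μ p).compLinearMap σ (fun j => Z j p) := fun Z =>
    lieDerivative_congr X μ _ _ p fun i => (hσ' _).symm
  rw [key Y, key s, ((lieDerivativeAlternating X μ p).compLinearMap σ).eq_smul_basis_det e,
    (μ.form p).eq_smul_basis_det e, ← he]
  simp only [AlternatingMap.smul_apply, smul_eq_mul, Module.Basis.det_self]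
  ring

theorem contMDiff_lieDerivative (X : SmoothVectorField n M) (μ : VolumeForm n M)
    (Y : Fin n → SmoothVectorField n M) :
    ContMDiff (𝓡 n) 𝓘(ℝ, ℝ) ∞ (lieDerivative X μ Y) := by
  refine ContMDiff.sub (contMDiff_mvfderiv_apply ⟨_, μ.smooth Y⟩ X) (ContMDiff.sum fun i _ => ?_)
  have h := μ.smooth (Function.update Y i ⟨_, contMDiff_mlieBracket X (Y i)⟩)
  simp only [update_apply_field] at h
  exact h

theorem existsUnique_divergence [T2Space M] (μ : VolumeForm n M) (X : SmoothVectorField n M) :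
    ∃! δ : SmoothFunction n M, IsDivergence μ X δ := by
  choose χ s h1 hs h3 using fun p : M => exists_frame (n := n) p
  have hne := fun p => form_frame_ne_zero μ (hs p).self_of_nhds
  let δ : M → ℝ := fun p => lieDerivative X μ (s p) p / μ.form p (fun j => s p j p)
  have hδ : ContMDiff (𝓡 n) 𝓘(ℝ, ℝ) ∞ δ := by
    intro p
    refine ContMDiffAt.congr_of_eventuallyEq
      ((contMDiff_lieDerivative X μ (s p) p).div₀ (μ.smooth (s p) p) (hne p)) ?_
    filter_upwards [hs p] with q hq
    have h4 := form_frame_ne_zero μ hq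
    have h5 := lieDerivative_mul_form X μ (s p) (s q) q hq
    simp only [δ]
    exact (div_eq_div_iff (hne q) h4).2 h5
  refine ⟨⟨δ, hδ⟩, fun Y p => ?_, fun δ' hδ' => ?_⟩
  · change _ = lieDerivative X μ (s p) p / μ.form p (fun j => s p j p) * _
    have h5 := lieDerivative_mul_form X μ (s p) Y p (hs p).self_of_nhds
    rw [div_mul_eq_mul_div, eq_div_iff (hne p), h5]
  · ext p
    exact (eq_div_iff (hne p)).2 (hδ' (s p) p).symm

/-! ### Gradients, divergence, Laplace operators -/

/-- The left-gradient `∇ᴸ_b F`. -/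
noncomputable def leftGradient [T2Space M] (b : GeometricStructure n M) (F : SmoothFunction n M) :
    SmoothVectorField n M :=
  (existsUnique_leftGradient b F).choose

/-- The right-gradient `∇ᴿ_b F`. -/
noncomputable def rightGradient [T2Space M] (b : GeometricStructure n M) (F : SmoothFunction n M) :
    SmoothVectorField n M :=
  (existsUnique_rightGradient b F).choose

/-- The divergence `div_μ X`. -/
noncomputable def divergence [T2Space M] (μ : VolumeForm n M) (X : SmoothVectorField n M) :
    SmoothFunction n M :=
  (existsUnique_divergence μ X).choose

/-- The left-Laplacian `Δᴸ_{b,μ} F = div_μ (∇ᴸ_b F)`. -/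
noncomputable def leftLaplacian [T2Space M] (b : GeometricStructure n M) (μ : VolumeForm n M)
    (F : SmoothFunction n M) : SmoothFunction n M :=
  divergence μ (leftGradient b F)

/-- The right-Laplacian `Δᴿ_{b,μ} F = div_μ (∇ᴿ_b F)`. -/
noncomputable def rightLaplacian [T2Space M] (b : GeometricStructure n M) (μ : VolumeForm n M)
    (F : SmoothFunction n M) : SmoothFunction n M :=
  divergence μ (rightGradient b F)

end

section
variable {n : ℕ} {M N : Type*}
  [TopologicalSpace M] [ChartedSpace (EuclideanSpace ℝ (Fin n)) M] [IsManifold (𝓡 n) ∞ M]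
  [TopologicalSpace N] [ChartedSpace (EuclideanSpace ℝ (Fin n)) N] [IsManifold (𝓡 n) ∞ N]

/-- The diffeomorphism `Φ` is a geometromorphism from `(M, bM)` to `(N, bN)`: `Φ^* bN = bM`. -/
def IsGeometromorphism (bM : GeometricStructure n M) (bN : GeometricStructure n N)
    (Φ : M ≃ₘ^∞⟮𝓡 n, 𝓡 n⟯ N) : Prop :=
  ∀ (p : M) (v w : TangentSpace (𝓡 n) p),
    bN.form (Φ p) (mfderiv (𝓡 n) (𝓡 n) Φ p v) (mfderiv (𝓡 n) (𝓡 n) Φ p w) = bM.form p v w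

/-- The diffeomorphism `Φ` preserves the volume forms: `Φ^* μN = μM`. -/
def PreservesVolume (μM : VolumeForm n M) (μN : VolumeForm n N)
    (Φ : M ≃ₘ^∞⟮𝓡 n, 𝓡 n⟯ N) : Prop :=
  ∀ (p : M) (v : Fin n → TangentSpace (𝓡 n) p),
    μN.form (Φ p) (fun i => mfderiv (𝓡 n) (𝓡 n) Φ p (v i)) = μM.form p v

/-- The pullback `Φ^* F = F ∘ Φ` of a smooth function. -/
noncomputable def pullbackFunction (Φ : M ≃ₘ^∞⟮𝓡 n, 𝓡 n⟯ N) (F : SmoothFunction n N) : SmoothFunction n M :=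
  ⟨fun p => F (Φ p), F.contMDiff.comp Φ.contMDiff⟩

end

end GeometricLaplacian

open GeometricLaplacian

namespace GeometricLaplacian

/-! Gradient and divergence are each determined uniquely by an equation built from natural
operations, so a diffeomorphism preserving `b` and `μ` must carry them along. It suffices to check
that the pulled-back object solves the defining equation on `M`; uniqueness then gives
`leftGradient_pullback` and `divergence_pullback`, and the Laplacian is their composite.

Naturality itself comes from the chain rule for functions and from the invariance of the Lie bracket
(`mfderiv_mlieBracket_pullbackField`), combined in `lieDerivative_pullback`.

One gap remains: the equations on `M` are tested on arbitrary fields of `M`, while the equations on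
`N` are known for fields of `N`. Only values at one point matter, so `exists_field_eq` supplies a
field on `N` with the required value at `Φ p`. For the gradient this is immediate; for the
divergence it rests on the tensoriality of the Lie derivative (`lieDerivative_congr`), since
brackets see more than values.

The right-hand statements are the left-hand ones for the flipped tensors. -/

theorem isInvertible_mfderiv_diffeomorph {n : ℕ} {M N : Type*}
    [TopologicalSpace M] [ChartedSpace (EuclideanSpace ℝ (Fin n)) M]
    [TopologicalSpace N] [ChartedSpace (EuclideanSpace ℝ (Fin n)) N]
    (Φ : M ≃ₘ^∞⟮𝓡 n, 𝓡 n⟯ N) (p : M) :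
    (mfderiv (𝓡 n) (𝓡 n) Φ p).IsInvertible :=
  ⟨Φ.mfderivToContinuousLinearEquiv (by simp) p, Φ.mfderivToContinuousLinearEquiv_coe (by simp)⟩

theorem mvfderiv_comp_diffeomorph {n : ℕ} {M N : Type*}
    [TopologicalSpace M] [ChartedSpace (EuclideanSpace ℝ (Fin n)) M]
    [TopologicalSpace N] [ChartedSpace (EuclideanSpace ℝ (Fin n)) N]
    (Φ : M ≃ₘ^∞⟮𝓡 n, 𝓡 n⟯ N) {f : N → ℝ}
    (hf : ContMDiff (𝓡 n) 𝓘(ℝ, ℝ) ∞ f) (p : M) (v : TangentSpace (𝓡 n) p) :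
    mvfderiv (𝓡 n) (fun q => f (Φ q)) p v
      = mvfderiv (𝓡 n) f (Φ p) (mfderiv (𝓡 n) (𝓡 n) Φ p v) :=
  mvfderiv_comp_apply p (hf.mdifferentiableAt (by simp))
    (Φ.contMDiff.mdifferentiableAt (by simp)) v

/-! ### Pullback of vector fields and brackets -/

section
variable {n : ℕ} {M N : Type*}
  [TopologicalSpace M] [ChartedSpace (EuclideanSpace ℝ (Fin n)) M] [IsManifold (𝓡 n) ∞ M]
  [TopologicalSpace N] [ChartedSpace (EuclideanSpace ℝ (Fin n)) N] [IsManifold (𝓡 n) ∞ N]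

/-- The pullback `Φ^* X` of a smooth vector field along a diffeomorphism. -/
noncomputable def pullbackField (Φ : M ≃ₘ^∞⟮𝓡 n, 𝓡 n⟯ N) (X : SmoothVectorField n N) :
    SmoothVectorField n M :=
  ⟨mpullback (𝓡 n) (𝓡 n) Φ X, by
    -- Pulling back a field involves the differential of `Φ` and so costs one derivative; at `∞`
    -- nothing is lost, because `∞ + 1 = ∞`.
    have h1 : IsManifold (𝓡 n) (((⊤ : ℕ∞) : WithTop ℕ∞) + 1) M := by
      rw [show (((⊤ : ℕ∞) : WithTop ℕ∞) + 1) = ∞ from rfl]; infer_instance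
    have h2 : IsManifold (𝓡 n) (((⊤ : ℕ∞) : WithTop ℕ∞) + 1) N := by
      rw [show (((⊤ : ℕ∞) : WithTop ℕ∞) + 1) = ∞ from rfl]; infer_instance
    exact ContMDiff.mpullback_vectorField (n := ∞) X.contMDiff Φ.contMDiff
      (isInvertible_mfderiv_diffeomorph Φ) (by simp)⟩

theorem pullbackField_apply (Φ : M ≃ₘ^∞⟮𝓡 n, 𝓡 n⟯ N) (X : SmoothVectorField n N) (p : M) :
    pullbackField Φ X p = (mfderiv (𝓡 n) (𝓡 n) Φ p).inverse (X (Φ p)) := rfl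

/-- The two fields are `Φ`-related, the form in which the pullback is mostly used below.
Invertibility of the differential is essential: `inverse` has the default value zero elsewhere. -/
theorem mfderiv_pullbackField (Φ : M ≃ₘ^∞⟮𝓡 n, 𝓡 n⟯ N) (X : SmoothVectorField n N) (p : M) :
    mfderiv (𝓡 n) (𝓡 n) Φ p (pullbackField Φ X p) = X (Φ p) :=
  (isInvertible_mfderiv_diffeomorph Φ p).self_apply_inverse _

theorem mfderiv_mlieBracket_pullbackField (Φ : M ≃ₘ^∞⟮𝓡 n, 𝓡 n⟯ N)
    (X Y : SmoothVectorField n N) (p : M) :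
    mfderiv (𝓡 n) (𝓡 n) Φ p (mlieBracket (𝓡 n) (pullbackField Φ X) (pullbackField Φ Y) p)
      = mlieBracket (𝓡 n) X Y (Φ p) := by
  have h2 : IsManifold (𝓡 n) (minSmoothness ℝ 3) M := by
    rw [minSmoothness_of_isRCLikeNormedField]; infer_instance
  have h3 : IsManifold (𝓡 n) (minSmoothness ℝ 3) N := by
    rw [minSmoothness_of_isRCLikeNormedField]; infer_instance
  have h := mpullback_mlieBracket (I := 𝓡 n) (I' := 𝓡 n) (f := Φ) (n := ∞) (x₀ := p)
    ((X.contMDiff (Φ p)).mdifferentiableAt (by simp))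
    ((Y.contMDiff (Φ p)).mdifferentiableAt (by simp)) (Φ.contMDiff p)
    (by rw [minSmoothness_of_isRCLikeNormedField]; exact WithTop.coe_le_coe.2 (le_top : (2 : ℕ∞) ≤ ⊤))
  change mfderiv (𝓡 n) (𝓡 n) Φ p
    (mlieBracket (𝓡 n) (mpullback (𝓡 n) (𝓡 n) Φ X) (mpullback (𝓡 n) (𝓡 n) Φ Y) p) = _
  -- The bracket of the pullbacks becomes the pullback of the bracket, that is, the inverse
  -- differential applied to it, and the outer differential cancels that inverse.
  rw [← h]
  exact (isInvertible_mfderiv_diffeomorph Φ p).self_apply_inverse _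

theorem IsGeometromorphism.flip {bM : GeometricStructure n M} {bN : GeometricStructure n N}
    {Φ : M ≃ₘ^∞⟮𝓡 n, 𝓡 n⟯ N} (hb : IsGeometromorphism bM bN Φ) :
    IsGeometromorphism bM.flip bN.flip Φ :=
  fun p v w => hb p w v

/-! ### Naturality of the gradients -/

theorem IsLeftGradient.pullback [T2Space N] {bM : GeometricStructure n M}
    {bN : GeometricStructure n N} {Φ : M ≃ₘ^∞⟮𝓡 n, 𝓡 n⟯ N} (hb : IsGeometromorphism bM bN Φ)
    {F : SmoothFunction n N} {G : SmoothVectorField n N} (hG : IsLeftGradient bN F G) :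
    IsLeftGradient bM (pullbackFunction Φ F) (pullbackField Φ G) := by
  intro X p
  -- `Z` need not be the pushforward of `X`: both sides of the gradient equation depend only on the
  -- value at the point.
  obtain ⟨Z, hZ⟩ := exists_field_eq (Φ p) (mfderiv (𝓡 n) (𝓡 n) Φ p (X p))
  rw [← hb, mfderiv_pullbackField, ← hZ, hG Z (Φ p), hZ]
  exact (mvfderiv_comp_diffeomorph Φ F.contMDiff p (X p)).symm

theorem leftGradient_pullback [T2Space M] [T2Space N] {bM : GeometricStructure n M}
    {bN : GeometricStructure n N} {Φ : M ≃ₘ^∞⟮𝓡 n, 𝓡 n⟯ N} (hb : IsGeometromorphism bM bN Φ)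
    (F : SmoothFunction n N) :
    leftGradient bM (pullbackFunction Φ F) = pullbackField Φ (leftGradient bN F) :=
  (existsUnique_leftGradient bM _).unique (existsUnique_leftGradient bM _).choose_spec.1
    (IsLeftGradient.pullback hb (existsUnique_leftGradient bN F).choose_spec.1)

/-- By definitional unfolding, the right-gradient for `b` is the left-gradient for `b.flip`. -/
theorem rightGradient_pullback [T2Space M] [T2Space N] {bM : GeometricStructure n M}
    {bN : GeometricStructure n N} {Φ : M ≃ₘ^∞⟮𝓡 n, 𝓡 n⟯ N} (hb : IsGeometromorphism bM bN Φ)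
    (F : SmoothFunction n N) :
    rightGradient bM (pullbackFunction Φ F) = pullbackField Φ (rightGradient bN F) :=
  leftGradient_pullback hb.flip F

/-! ### Naturality of the Lie derivative and the divergence -/

theorem lieDerivative_pullback {μM : VolumeForm n M} {μN : VolumeForm n N}
    {Φ : M ≃ₘ^∞⟮𝓡 n, 𝓡 n⟯ N} (hμ : PreservesVolume μM μN Φ) (X : SmoothVectorField n N)
    (Y : Fin n → SmoothVectorField n N) (p : M) :
    lieDerivative (pullbackField Φ X) μM (fun i => pullbackField Φ (Y i)) p
      = lieDerivative X μN Y (Φ p) := by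
  -- An identity of functions, not just of values at `p`, because this term gets differentiated.
  have hform : (fun q => μM.form q (fun i => pullbackField Φ (Y i) q))
      = fun q => (fun r => μN.form r (fun i => Y i r)) (Φ q) := by
    funext q
    rw [← hμ]
    simp only [mfderiv_pullbackField]
  unfold lieDerivative
  rw [hform, mvfderiv_comp_diffeomorph Φ (μN.smooth Y), mfderiv_pullbackField]
  congr 1
  refine Finset.sum_congr rfl fun i _ => ?_
  rw [← hμ]
  congr 1
  funext j
  -- Slot `i` holds the bracket and needs its invariance; the other slots hold `Φ`-related fields.
  by_cases h : j = i
  · subst h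
    simp only [Function.update_self]
    exact mfderiv_mlieBracket_pullbackField Φ X (Y j) p
  · simp only [Function.update_of_ne h]
    exact mfderiv_pullbackField Φ (Y j) p

theorem IsDivergence.pullback [T2Space M] [T2Space N] {μM : VolumeForm n M} {μN : VolumeForm n N}
    {Φ : M ≃ₘ^∞⟮𝓡 n, 𝓡 n⟯ N} (hμ : PreservesVolume μM μN Φ) {X : SmoothVectorField n N}
    {δ : SmoothFunction n N} (hδ : IsDivergence μN X δ) :
    IsDivergence μM (pullbackField Φ X) (pullbackFunction Φ δ) := by
  intro Y p
  choose Z hZ using fun i => exists_field_eq (Φ p) (mfderiv (𝓡 n) (𝓡 n) Φ p (Y i p))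
  have hYZ : ∀ i, Y i p = pullbackField Φ (Z i) p := fun i => by
    rw [pullbackField_apply, hZ]
    exact ((isInvertible_mfderiv_diffeomorph Φ p).inverse_apply_self _).symm
  -- The fields `Y i` and the pullbacks of `Z i` agree only at `p`, so their brackets with the
  -- pullback of `X` may differ there; tensoriality makes the full Lie derivatives equal all the
  -- same.
  rw [lieDerivative_congr _ _ Y (fun i => pullbackField Φ (Z i)) p hYZ, lieDerivative_pullback hμ,
    hδ Z (Φ p), ← hμ]
  simp only [hZ]
  rfl

theorem divergence_pullback [T2Space M] [T2Space N] {μM : VolumeForm n M} {μN : VolumeForm n N}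
    {Φ : M ≃ₘ^∞⟮𝓡 n, 𝓡 n⟯ N} (hμ : PreservesVolume μM μN Φ) (X : SmoothVectorField n N) :
    divergence μM (pullbackField Φ X) = pullbackFunction Φ (divergence μN X) :=
  (existsUnique_divergence μM _).unique (existsUnique_divergence μM _).choose_spec.1
    (IsDivergence.pullback hμ (existsUnique_divergence μN X).choose_spec.1)

end

end GeometricLaplacian

theorem theorem4p9 {n : ℕ} {M : Type*} {N : Type*}
    [TopologicalSpace M] [T2Space M] [ParacompactSpace M] [ConnectedSpace M]
    [ChartedSpace (EuclideanSpace ℝ (Fin n)) M] [IsManifold (𝓡 n) ∞ M]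
    [TopologicalSpace N] [T2Space N] [ParacompactSpace N] [ConnectedSpace N]
    [ChartedSpace (EuclideanSpace ℝ (Fin n)) N] [IsManifold (𝓡 n) ∞ N]
    (bM : GeometricStructure n M) (μM : VolumeForm n M)
    (bN : GeometricStructure n N) (μN : VolumeForm n N)
    (Φ : M ≃ₘ^∞⟮𝓡 n, 𝓡 n⟯ N)
    (hb : IsGeometromorphism bM bN Φ) (hμ : PreservesVolume μM μN Φ) :
    ∀ F : SmoothFunction n N,
      leftLaplacian bM μM (pullbackFunction Φ F) = pullbackFunction Φ (leftLaplacian bN μN F) ∧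
      rightLaplacian bM μM (pullbackFunction Φ F) = pullbackFunction Φ (rightLaplacian bN μN F) := by

  intro F
  constructor
  · rw [leftLaplacian, leftGradient_pullback hb, divergence_pullback hμ, leftLaplacian]
  · rw [rightLaplacian, rightGradient_pullback hb, divergence_pullback hμ, rightLaplacian]
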